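/- Let $\Omega$ be a non-empty set and $\mathfrak F(\Omega)$ the set of all functions $\Omega\to\mathbb R$, with pointwise order $\ge$. Let $\ge_*$ be a reflexive and transitive relation on $\mathfrak F(\Omega)$, with asymmetric part $>_*$, such that: $1>_*0$; $f\ge g$ implies $f\ge_*g$; $f\ge_*g$ implies $bf+h\ge_*bg+h$ for every bounded $b\ge0$ and every $h\in\mathfrak F(\Omega)$; and $f>_*0$ implies $f\wedge1>_*0$. A set $A\subset\Omega$ is negligible if $0\ge_*\mathbf 1_A$. For $S\subset\mathfrak F(\Omega)$ containing $1$, a *price function* on $S$ is a map $\rho:S\to\mathbb R$ with $\rho(1)=1$ which is positively homogeneous ($\rho(cX)=c\rho(X)$ if $c>0$ and $X,cX\in S$), subadditive ($\rho(X+Y)\le\rho(X)+\rho(Y)$ if $X,Y,X+Y\in S$), monotone ($\rho(X)\ge\rho(Y)$ if $X,Y\in S$, $X\ge_*Y$) and arbitrage-free ($\rho(X)>0$ if $X\in S$, $X>_*0$). It is *cash additive* if $\rho(X+a)=\rho(X)+a$ whenever $a\in\mathbb R$ and $X,X+a\in S$. A *market* $(\mathscr X,\ge_*,\pi)$ consists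 of a relation $\ge_*$ as above, a convex set $\mathscr X\subset\mathfrak F(\Omega)$ containing $0$ and $1$, such that each $X\in\mathscr X$ satisfies $X\ge_*a$ for some $a\in\mathbb R$, and such that $X+\lambda\in\mathscr X$ for all $X\in\mathscr X$, $\lambda\ge0$; and a price function $\pi$ on $\mathscr X$. Put $$L(\mathscr X)=\{g\in\mathfrak F(\Omega):\lambda X\ge_*|g|\text{ for some }\lambda>0,\ X\in\mathscr X\},$$ $$\mathscr C(\pi)=\{g\in\mathfrak F(\Omega):\lambda[X-\pi(X)]\ge_*g\text{ for some }\lambda>0,\ X\in\mathscr X\},$$ and let $\overline{\mathscr C(\pi)}^{u}$ be the closure of $\mathscr C(\pi)$ in $\mathfrak F(\Omega)$ for the topology of uniform distance. Let $\mathscr M_0(\pi)$ be the set of finitely additive probabilities $m$ on the power set of $\Omega$ that vanish on all negligible sets and satisfy $L(\mathscr X)\subset L^1(m)$ and $\int X\,dm\le\pi(X)$ for every $X\in\mathscr X$ (integrals in the sense of Dunford and Schwartz). **Theorem.** For a market $(\mathscr X,\ge_*,\pi)$ the following are equivalent: (a) $\overline{\mathscr C(\pi)}^{u}\cap\{f\in\mathfrak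 F(\Omega):f>_*0\}=\emptyset$; (b) there is a cash additive price function $\rho$ on $L(\mathscr X)$ with $\rho(X)\le\pi(X)$ for every $X\in\mathscr X$ (a cash additive completion of the market); (c) $\sup_{m\in\mathscr M_0(\pi)}\int(f\wedge1)\,dm>0$ for every $f\in\mathfrak F(\Omega)$ with $f>_*0$. -/

import Mathlib

open Filter Topology

namespace FinAdd

/-- A real-valued, finitely additive set function on the power set of `Ω`. -/
abbrev SetFunction (Ω : Type*) := MeasureTheory.AddContent ℝ (Set.univ : Set (Set Ω))

/-- The finitely additive probabilities on the power set of `Ω`. -/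
def Prob (Ω : Type*) : Set (SetFunction Ω) :=
  {m | (∀ A : Set Ω, 0 ≤ m A) ∧ m Set.univ = 1}

variable {Ω : Type*}

/-- A simple function is a function of finite range (every subset of `Ω` is measurable). -/
def IsSimple (s : Ω → ℝ) : Prop := (Set.range s).Finite

/-- The elementary integral `∑ y, m {s = y} * y` of a simple function `s`. -/
noncomputable def simpleIntegral (m : SetFunction Ω) (s : Ω → ℝ) : ℝ :=
  ∑ᶠ y : ℝ, m (s ⁻¹' {y}) * y

/-- `s n` converges to `f` in `m`-measure. -/
def TendstoInProb (m : SetFunction Ω) (s : ℕ → Ω → ℝ) (f : Ω → ℝ) : Prop :=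
  ∀ ε : ℝ, 0 < ε → Tendsto (fun n => m {ω | ε < |f ω - s n ω|}) atTop (𝓝 0)

/-- A determining sequence for `f`, in the sense of Dunford and Schwartz: simple functions that
converge to `f` in `m`-measure and are Cauchy for the distance `∫ |s - t| dm`. -/
structure IsDetermining (m : SetFunction Ω) (s : ℕ → Ω → ℝ) (f : Ω → ℝ) : Prop where
  simple : ∀ n, IsSimple (s n)
  tendsto : TendstoInProb m s f
  cauchy : ∀ ε : ℝ, 0 < ε → ∃ N : ℕ, ∀ n ≥ N, ∀ k ≥ N,
    simpleIntegral m (fun ω => |s n ω - s k ω|) < ε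

/-- `f ∈ L¹(m)`. -/
def Integrable (m : SetFunction Ω) (f : Ω → ℝ) : Prop :=
  ∃ s : ℕ → Ω → ℝ, IsDetermining m s f

/-- `f ∈ L¹(m)` and `∫ f dm = I`. -/
def HasIntegral (m : SetFunction Ω) (f : Ω → ℝ) (I : ℝ) : Prop :=
  ∃ s : ℕ → Ω → ℝ, IsDetermining m s f ∧
    Tendsto (fun n => simpleIntegral m (s n)) atTop (𝓝 I)

open Classical in
/-- The integral `∫ f dm` of `f ∈ L¹(m)` (and `0` if `f` is not integrable). It does not depend on
the choices made here: see `HasIntegral.unique` and `Integrable.hasIntegral`. -/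
noncomputable def integral (m : SetFunction Ω) (f : Ω → ℝ) : ℝ :=
  if h : ∃ I : ℝ, HasIntegral m f I then h.choose else 0

theorem IsSimple.map₂ {s t : Ω → ℝ} (hs : IsSimple s) (ht : IsSimple t) (φ : ℝ → ℝ → ℝ) :
    IsSimple (fun ω => φ (s ω) (t ω)) := by
  refine ((hs.prod ht).image (fun p => φ p.1 p.2)).subset ?_
  rintro _ ⟨ω, rfl⟩
  exact ⟨(s ω, t ω), ⟨⟨ω, rfl⟩, ⟨ω, rfl⟩⟩, rfl⟩

/-- The vector-valued set function that turns `simpleIntegral` into `setToSimpleFunc`. -/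
noncomputable def contentMap (m : SetFunction Ω) (A : Set Ω) : ℝ →L[ℝ] ℝ :=
  m A • ContinuousLinearMap.id ℝ ℝ

theorem simpleIntegral_eq (m : SetFunction Ω)
    (s : @MeasureTheory.SimpleFunc Ω ⊤ ℝ) :
    simpleIntegral m (@MeasureTheory.SimpleFunc.toFun Ω ⊤ ℝ s) =
      @MeasureTheory.SimpleFunc.setToSimpleFunc Ω ℝ ℝ _ _ _ _ ⊤ (contentMap m) s := by
  let _ : MeasurableSpace Ω := ⊤
  unfold simpleIntegral MeasureTheory.SimpleFunc.setToSimpleFunc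
  rw [finsum_eq_sum_of_support_subset (s := s.range)]
  · rfl
  · intro y hy
    by_contra hn
    apply hy
    have : s.toFun ⁻¹' {y} = ∅ := by
      ext ω
      simp only [Set.mem_preimage, Set.mem_singleton_iff, Set.mem_empty_iff_false, iff_false]
      rintro rfl
      exact hn (by simpa using ⟨ω, rfl⟩)
    simp [this]

theorem T_add (m : SetFunction Ω) :
    @MeasureTheory.FinMeasAdditive Ω _ _ ⊤ (@MeasureTheory.Measure.instZero Ω ⊤).zero (contentMap m) := by
  intro A B _ _ _ _ hAB
  have h : m (A ∪ B) = m A + m B :=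
    MeasureTheory.addContent_union' (Set.mem_univ _) (Set.mem_univ _) (Set.mem_univ _) hAB
  simp [contentMap, h, add_smul]

theorem simpleIntegral_add (m : SetFunction Ω) {s t : Ω → ℝ} (hs : IsSimple s)
    (ht : IsSimple t) :
    simpleIntegral m (fun ω => s ω + t ω) = simpleIntegral m s + simpleIntegral m t := by
  let _ : MeasurableSpace Ω := ⊤
  let S : MeasureTheory.SimpleFunc Ω ℝ := ⟨s, fun _ => trivial, hs⟩
  let U : MeasureTheory.SimpleFunc Ω ℝ := ⟨t, fun _ => trivial, ht⟩
  have := MeasureTheory.SimpleFunc.setToSimpleFunc_add (contentMap m) (T_add m) (f := S) (g := U)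
    (MeasureTheory.integrable_zero_measure) (MeasureTheory.integrable_zero_measure)
  rw [← simpleIntegral_eq, ← simpleIntegral_eq, ← simpleIntegral_eq] at this
  exact this

theorem simpleIntegral_mono {m : SetFunction Ω} (hm : m ∈ Prob Ω) {s t : Ω → ℝ}
    (hs : IsSimple s) (ht : IsSimple t) (hst : ∀ ω, s ω ≤ t ω) :
    simpleIntegral m s ≤ simpleIntegral m t := by
  let _ : MeasurableSpace Ω := ⊤
  let S : MeasureTheory.SimpleFunc Ω ℝ := ⟨s, fun _ => trivial, hs⟩
  let U : MeasureTheory.SimpleFunc Ω ℝ := ⟨t, fun _ => trivial, ht⟩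
  have := MeasureTheory.SimpleFunc.setToSimpleFunc_mono (T := contentMap m) (T_add m)
    (fun A _ _ x hx => by simpa [contentMap] using mul_nonneg (hm.1 A) hx) (f := S) (g := U)
    (MeasureTheory.integrable_zero_measure) (MeasureTheory.integrable_zero_measure) hst
  rw [← simpleIntegral_eq, ← simpleIntegral_eq] at this
  exact this

open Classical in
theorem simpleIntegral_indicator (m : SetFunction Ω) (A : Set Ω) (c : ℝ) :
    simpleIntegral m (A.indicator fun _ => c) = m A * c := by
  let _ : MeasurableSpace Ω := ⊤
  have := MeasureTheory.SimpleFunc.setToSimpleFunc_indicator (contentMap m) (by simp [contentMap])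
    (show MeasurableSet A from trivial) c
  rw [← simpleIntegral_eq] at this
  have h2 : contentMap m A c = m A * c := by simp [contentMap]
  rw [← h2, ← this]
  congr 1

theorem simpleIntegral_const {m : SetFunction Ω} (hm : m ∈ Prob Ω) (c : ℝ) :
    simpleIntegral m (fun _ => c) = c := by
  have := simpleIntegral_indicator m Set.univ c
  rwa [Set.indicator_univ, hm.2, one_mul] at this

theorem simpleIntegral_sub (m : SetFunction Ω) {s t : Ω → ℝ} (hs : IsSimple s)
    (ht : IsSimple t) :
    simpleIntegral m (fun ω => s ω - t ω) = simpleIntegral m s - simpleIntegral m t := by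
  have := simpleIntegral_add m (hs.map₂ ht (fun x y => x - y)) ht
  simp only [sub_add_cancel] at this
  linarith

theorem abs_simpleIntegral_sub_le {m : SetFunction Ω} (hm : m ∈ Prob Ω) {s t : Ω → ℝ}
    (hs : IsSimple s) (ht : IsSimple t) :
    |simpleIntegral m s - simpleIntegral m t| ≤ simpleIntegral m (fun ω => |s ω - t ω|) := by
  have hd := hs.map₂ ht (fun x y => |x - y|)
  rw [abs_le]
  constructor
  · have h1 := simpleIntegral_mono hm ht (hs.map₂ hd (fun x y => x + y))
      (fun ω => by have := neg_abs_le (s ω - t ω); linarith)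
    rw [simpleIntegral_add m hs hd] at h1
    linarith
  · have h1 := simpleIntegral_mono hm hs (ht.map₂ hd (fun x y => x + y))
      (fun ω => by have := le_abs_self (s ω - t ω); linarith)
    rw [simpleIntegral_add m ht hd] at h1
    linarith

theorem prob_mono {m : SetFunction Ω} (hm : m ∈ Prob Ω) {A B : Set Ω} (h : A ⊆ B) :
    m A ≤ m B := by
  have := MeasureTheory.addContent_union' (m := m) (s := A) (t := B \ A) (Set.mem_univ _)
    (Set.mem_univ _) (Set.mem_univ _) Set.disjoint_sdiff_right
  rw [Set.union_sdiff_cancel h] at this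
  have := hm.1 (B \ A)
  linarith

theorem prob_union_le {m : SetFunction Ω} (hm : m ∈ Prob Ω) (A B : Set Ω) :
    m (A ∪ B) ≤ m A + m B := by
  have := MeasureTheory.addContent_union' (m := m) (s := A) (t := B \ A) (Set.mem_univ _)
    (Set.mem_univ _) (Set.mem_univ _) Set.disjoint_sdiff_right
  rw [Set.union_sdiff_self] at this
  have := prob_mono hm (Set.sdiff_subset (s := B) (t := A))
  linarith

/-- The integrals along two determining sequences have the same limit. -/
theorem HasIntegral.unique {m : SetFunction Ω} (hm : m ∈ Prob Ω) {f : Ω → ℝ} {I J : ℝ}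
    (hI : HasIntegral m f I) (hJ : HasIntegral m f J) : I = J := by
  obtain ⟨s, hs, hsI⟩ := hI
  obtain ⟨t, ht, htJ⟩ := hJ
  have hle : |I - J| ≤ 0 := by
    refine le_of_forall_pos_le_add fun ε hε => ?_
    have hlim := (hsI.sub htJ).abs
    refine le_of_tendsto hlim ?_
    obtain ⟨N₁, hN₁⟩ := hs.cauchy (ε / 4) (by linarith)
    obtain ⟨N₂, hN₂⟩ := ht.cauchy (ε / 4) (by linarith)
    set N := max N₁ N₂
    have hu : IsSimple (fun ω => |s N ω - t N ω|) :=
      (hs.simple N).map₂ (ht.simple N) (fun x y => |x - y|)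
    obtain ⟨K, hK⟩ := hu.bddAbove
    have hK' : ∀ ω, |s N ω - t N ω| ≤ |K| := fun ω => (hK ⟨ω, rfl⟩).trans (le_abs_self K)
    have hm1 := hs.tendsto (ε / 8) (by linarith)
    have hm2 := ht.tendsto (ε / 8) (by linarith)
    have hm3 := (hm1.add hm2).mul_const |K|
    rw [add_zero, zero_mul] at hm3
    filter_upwards [hm3.eventually (gt_mem_nhds (show (0 : ℝ) < ε / 4 by linarith)),
      eventually_ge_atTop N] with n hn hnN
    have hn1 := hN₁ n ((le_max_left _ _).trans hnN) N (le_max_left _ _)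
    have hn2 := hN₂ n ((le_max_right _ _).trans hnN) N (le_max_right _ _)
    set A : Set Ω := {ω | ε / 8 < |f ω - s n ω|} ∪ {ω | ε / 8 < |f ω - t n ω|}
    have hA := prob_union_le hm {ω | ε / 8 < |f ω - s n ω|} {ω | ε / 8 < |f ω - t n ω|}
    have ha : IsSimple (fun ω => |s n ω - s N ω|) :=
      (hs.simple n).map₂ (hs.simple N) (fun x y => |x - y|)
    have hb : IsSimple (fun ω => |t n ω - t N ω|) :=
      (ht.simple n).map₂ (ht.simple N) (fun x y => |x - y|)
    have hc : IsSimple (fun _ : Ω => ε / 4) := Set.finite_range_const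
    have hd : IsSimple (A.indicator fun _ => |K|) := by
      refine (Set.toFinite {0, |K|}).subset ?_
      rintro _ ⟨ω, rfl⟩
      by_cases h : ω ∈ A <;> simp [h]
    have hab := ha.map₂ hb (fun x y => x + y)
    have hcd := hc.map₂ hd (fun x y => x + y)
    have key := simpleIntegral_mono hm
      ((hs.simple n).map₂ (ht.simple n) (fun x y => |x - y|))
      (hab.map₂ hcd (fun x y => x + y)) (fun ω => by
        by_cases h : ω ∈ A
        · have e : s n ω - t n ω = (s n ω - s N ω) + (s N ω - t N ω) - (t n ω - t N ω) := by ring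
          have h1 := abs_sub ((s n ω - s N ω) + (s N ω - t N ω)) (t n ω - t N ω)
          have h2 := abs_add_le (s n ω - s N ω) (s N ω - t N ω)
          have h3 := hK' ω
          simp only [Set.indicator_of_mem h]
          rw [e]
          linarith
        · have h' := h
          simp only [A, Set.mem_union, Set.mem_ofPred_eq, not_or, not_lt] at h'
          have e : s n ω - t n ω = (f ω - t n ω) - (f ω - s n ω) := by ring
          have h1 := abs_sub (f ω - t n ω) (f ω - s n ω)
          simp only [Set.indicator_of_notMem h]
          rw [e]
          have := abs_nonneg (s n ω - s N ω)
          have := abs_nonneg (t n ω - t N ω)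
          linarith [h'.1, h'.2])
    rw [simpleIntegral_add m hab hcd, simpleIntegral_add m ha hb, simpleIntegral_add m hc hd,
      simpleIntegral_const hm, simpleIntegral_indicator] at key
    have h0 := abs_simpleIntegral_sub_le hm (hs.simple n) (ht.simple n)
    have h5 : m A * |K| ≤ (m {ω | ε / 8 < |f ω - s n ω|} + m {ω | ε / 8 < |f ω - t n ω|}) * |K| :=
      mul_le_mul_of_nonneg_right hA (abs_nonneg K)
    linarith
  linarith [abs_eq_zero.mp (le_antisymm hle (abs_nonneg _))]

theorem Integrable.hasIntegral {m : SetFunction Ω} (hm : m ∈ Prob Ω) {f : Ω → ℝ}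
    (hf : Integrable m f) : HasIntegral m f (integral m f) := by
  have h : ∃ I : ℝ, HasIntegral m f I := by
    obtain ⟨s, hs⟩ := hf
    have hc : CauchySeq (fun n => simpleIntegral m (s n)) := by
      refine Metric.cauchySeq_iff.mpr fun ε hε => ?_
      obtain ⟨N, hN⟩ := hs.cauchy ε hε
      exact ⟨N, fun n hn k hk =>
        (abs_simpleIntegral_sub_le hm (hs.simple n) (hs.simple k)).trans_lt (hN n hn k hk)⟩
    obtain ⟨I, hI⟩ := cauchySeq_tendsto_of_complete hc
    exact ⟨I, s, hs, hI⟩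
  rw [integral, dif_pos h]
  exact h.choose_spec

end FinAdd

namespace Economy

variable {Ω : Type*}

/-- The asymmetric part `f >_* g` of the relation `ge`. -/
def Gt (ge : (Ω → ℝ) → (Ω → ℝ) → Prop) (f g : Ω → ℝ) : Prop := ge f g ∧ ¬ ge g f

/-- The axioms of the criterion of collective rationality `f ≥_* g`, written `ge f g`. -/
structure IsCommonOrder (ge : (Ω → ℝ) → (Ω → ℝ) → Prop) : Prop where
  refl : ∀ f, ge f f
  trans : ∀ f g h, ge f g → ge g h → ge f h
  one_gt_zero : Gt ge 1 0
  of_le : ∀ f g : Ω → ℝ, g ≤ f → ge f g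
  affine : ∀ f g b h : Ω → ℝ, ge f g → 0 ≤ b → (∃ K : ℝ, ∀ ω, b ω ≤ K) →
    ge (b * f + h) (b * g + h)
  trunc : ∀ f, Gt ge f 0 → Gt ge (f ⊓ 1) 0

/-- The negligible sets: `0 ≥_* 1_A`. -/
def Negligible (ge : (Ω → ℝ) → (Ω → ℝ) → Prop) : Set (Set Ω) :=
  {A | ge 0 (A.indicator 1)}

/-- `π` is a price function on the set of payoffs `S`: normalized, positively homogeneous,
subadditive, `ge`-monotone and free of arbitrage. The values of `π` off `S` play no role. -/
structure IsPriceFunction (ge : (Ω → ℝ) → (Ω → ℝ) → Prop) (S : Set (Ω → ℝ))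
    (π : (Ω → ℝ) → ℝ) : Prop where
  one : π 1 = 1
  pos_homogeneous : ∀ (c : ℝ), 0 < c → ∀ X ∈ S, c • X ∈ S → π (c • X) = c * π X
  subadditive : ∀ X ∈ S, ∀ Y ∈ S, X + Y ∈ S → π (X + Y) ≤ π X + π Y
  mono : ∀ X ∈ S, ∀ Y ∈ S, ge X Y → π Y ≤ π X
  no_arbitrage : ∀ X ∈ S, Gt ge X 0 → 0 < π X

/-- `(𝒳, ge, π)` is a market. -/
structure IsMarket (ge : (Ω → ℝ) → (Ω → ℝ) → Prop) (𝒳 : Set (Ω → ℝ))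
    (π : (Ω → ℝ) → ℝ) : Prop where
  order : IsCommonOrder ge
  convex : Convex ℝ 𝒳
  zero_mem : (0 : Ω → ℝ) ∈ 𝒳
  one_mem : (1 : Ω → ℝ) ∈ 𝒳
  bounded_loss : ∀ X ∈ 𝒳, ∃ a : ℝ, ge X (fun _ => a)
  add_const_mem : ∀ X ∈ 𝒳, ∀ c : ℝ, 0 ≤ c → (X + fun _ => c) ∈ 𝒳
  price : IsPriceFunction ge 𝒳 π

/-- The lattice `L(𝒳)` of superhedgeable claims (the complete market). -/
def completeMarket (ge : (Ω → ℝ) → (Ω → ℝ) → Prop) (𝒳 : Set (Ω → ℝ)) : Set (Ω → ℝ) :=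
  {g | ∃ c : ℝ, 0 < c ∧ ∃ X ∈ 𝒳, ge (c • X) |g|}

/-- The cone `C(π)` of claims dominated by some `c (X - π(X))`, `c > 0`, `X ∈ 𝒳`. -/
def superhedgeCone (ge : (Ω → ℝ) → (Ω → ℝ) → Prop) (𝒳 : Set (Ω → ℝ))
    (π : (Ω → ℝ) → ℝ) : Set (Ω → ℝ) :=
  {g | ∃ c : ℝ, 0 < c ∧ ∃ X ∈ 𝒳, ge (c • (X - fun _ => π X)) g}

/-- Closure in the topology of uniform distance on all real functions on `Ω`. -/
def uniformClosure (A : Set (Ω → ℝ)) : Set (Ω → ℝ) :=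
  {f | UniformFun.ofFun f ∈ closure (UniformFun.ofFun '' A)}

/-- Cash additivity of `π` on `S`. -/
def CashAdditive (S : Set (Ω → ℝ)) (π : (Ω → ℝ) → ℝ) : Prop :=
  ∀ X ∈ S, ∀ a : ℝ, (X + fun _ => a) ∈ S → π (X + fun _ => a) = π X + a

/-- `ρ` is a cash additive completion of the market: a cash additive price function on `L(𝒳)`
whose restriction to `𝒳` does not exceed `π`. -/
structure IsCashAdditiveCompletion (ge : (Ω → ℝ) → (Ω → ℝ) → Prop) (𝒳 : Set (Ω → ℝ))
    (π ρ : (Ω → ℝ) → ℝ) : Prop where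
  price : IsPriceFunction ge (completeMarket ge 𝒳) ρ
  le : ∀ X ∈ 𝒳, ρ X ≤ π X
  cashAdditive : CashAdditive (completeMarket ge 𝒳) ρ

/-- The pricing measures: finitely additive probabilities `m` vanishing on negligible sets, with
`L(𝒳) ⊆ L¹(m)` and `∫ X dm ≤ π(X)` for every `X ∈ 𝒳`. -/
def pricingMeasures (ge : (Ω → ℝ) → (Ω → ℝ) → Prop) (𝒳 : Set (Ω → ℝ))
    (π : (Ω → ℝ) → ℝ) : Set (FinAdd.SetFunction Ω) :=
  {m | m ∈ FinAdd.Prob Ω ∧ (∀ A ∈ Negligible ge, m A = 0) ∧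
    (∀ g ∈ completeMarket ge 𝒳, FinAdd.Integrable m g) ∧
    ∀ X ∈ 𝒳, FinAdd.integral m X ≤ π X}

end Economy

/-! (a) ⇒ (b). The completion is the superhedging price `ρ(f) = inf {a : f - a ∈ C(π)}`. The set
`C(π)` is a convex cone containing with each claim every `≥_*`-smaller one, which makes `ρ`
sublinear, monotone and cash additive. It is finite because (a) keeps positive constants out of
`C(π)`. If `f >_* 0` had `ρ(f) ≤ 0`, then `f - ε/2 ∈ C(π)` for all `ε > 0`, so that `f` would lie in
the uniform closure.

(b) ⇒ (c). If `f >_* 0`, then `f ∧ 1 >_* 0` lies in `L(𝒳)`, and Hahn–Banach (`exists_linear_le`)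
gives a linear `φ ≤ ρ` on `L(𝒳)` with `φ(f ∧ 1) = ρ(f ∧ 1) > 0`. Monotonicity of `ρ` makes `φ`
positive and null on negligible sets; cash additivity forces `φ(1) = 1`. Put `m(A) = φ(1_A)`. For `0
≤ g ∈ L(𝒳)` the `m`-integral is `lim φ(g ∧ n)`, which may fall short of `φ(g)`: `φ` can have a part
that vanishes on bounded functions. The loss is harmless (`exists_hasIntegral_of_nonneg`). Payoffs
are bounded below up to a negligible part, so it goes in the direction `∫ X dm ≤ φ(X) ≤ π(X)`; and
it is absent for bounded functions, so `∫ (f ∧ 1) dm = φ(f ∧ 1) > 0`.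

(c) ⇒ (a). If `f` is in the closure, then `f ∧ 1 - ε ≤ g` for some `g` with `c (X - π(X)) ≥_* g`.
Integration against any pricing measure respects `≥_*` and gives `∫ (f ∧ 1) dm ≤ ε`. -/

namespace FinAdd

variable {Ω : Type*}

/-! ### Calculus of the Dunford–Schwartz integral. -/

theorem IsSimple.map {s : Ω → ℝ} (hs : IsSimple s) (φ : ℝ → ℝ) : IsSimple (fun ω => φ (s ω)) :=
  hs.map₂ hs (fun x _ => φ x)

theorem simpleIntegral_const_mul (m : SetFunction Ω) {s : Ω → ℝ} (hs : IsSimple s) (c : ℝ) :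
    simpleIntegral m (fun ω => c * s ω) = c * simpleIntegral m s := by
  let _ : MeasurableSpace Ω := ⊤
  let S : MeasureTheory.SimpleFunc Ω ℝ := ⟨s, fun _ => trivial, hs⟩
  have := MeasureTheory.SimpleFunc.setToSimpleFunc_smul_real (contentMap m) (T_add m) c (f := S)
    (MeasureTheory.integrable_zero_measure)
  rw [← simpleIntegral_eq, ← simpleIntegral_eq] at this
  exact this

theorem prob_le_of_subset_union {m : SetFunction Ω} (hm : m ∈ Prob Ω) {A B C : Set Ω}
    (h : A ⊆ B ∪ C) : m A ≤ m B + m C :=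
  (prob_mono hm h).trans (prob_union_le hm B C)

theorem TendstoInProb.of_le {m : SetFunction Ω} (hm : m ∈ Prob Ω) {s : ℕ → Ω → ℝ} {f : Ω → ℝ}
    (u : ℝ → ℕ → ℝ) (hu : ∀ ε, 0 < ε → Tendsto (u ε) atTop (𝓝 0))
    (h : ∀ ε, 0 < ε → ∀ᶠ n in atTop, m {ω | ε < |f ω - s n ω|} ≤ u ε n) :
    TendstoInProb m s f := fun ε hε =>
  tendsto_of_tendsto_of_tendsto_of_le_of_le' tendsto_const_nhds (hu ε hε)
    (Eventually.of_forall fun _ => hm.1 _) (h ε hε)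

theorem IsDetermining.add {m : SetFunction Ω} (hm : m ∈ Prob Ω) {s t : ℕ → Ω → ℝ} {f g : Ω → ℝ}
    (hs : IsDetermining m s f) (ht : IsDetermining m t g) :
    IsDetermining m (fun n ω => s n ω + t n ω) (fun ω => f ω + g ω) where
  simple n := (hs.simple n).map₂ (ht.simple n) (fun x y => x + y)
  tendsto := by
    refine TendstoInProb.of_le hm
      (fun ε n => m {ω | ε / 2 < |f ω - s n ω|} + m {ω | ε / 2 < |g ω - t n ω|})
      (fun ε hε => by
        simpa using (hs.tendsto (ε / 2) (half_pos hε)).add (ht.tendsto (ε / 2) (half_pos hε)))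
      (fun ε hε => Eventually.of_forall fun n => prob_le_of_subset_union hm fun ω hω => ?_)
    by_contra h
    simp only [Set.mem_union, Set.mem_ofPred_eq, not_or, not_lt] at h hω
    have e : f ω + g ω - (s n ω + t n ω) = (f ω - s n ω) + (g ω - t n ω) := by ring
    have := abs_add_le (f ω - s n ω) (g ω - t n ω)
    rw [e] at hω
    linarith [h.1, h.2]
  cauchy ε hε := by
    obtain ⟨N₁, hN₁⟩ := hs.cauchy (ε / 2) (half_pos hε)
    obtain ⟨N₂, hN₂⟩ := ht.cauchy (ε / 2) (half_pos hε)
    refine ⟨max N₁ N₂, fun n hn k hk => ?_⟩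
    have h1 := hN₁ n ((le_max_left _ _).trans hn) k ((le_max_left _ _).trans hk)
    have h2 := hN₂ n ((le_max_right _ _).trans hn) k ((le_max_right _ _).trans hk)
    have ha := (hs.simple n).map₂ (hs.simple k) (fun x y => |x - y|)
    have hb := (ht.simple n).map₂ (ht.simple k) (fun x y => |x - y|)
    have h3 := simpleIntegral_mono hm
      (((hs.simple n).map₂ (ht.simple n) (fun x y => x + y)).map₂
        ((hs.simple k).map₂ (ht.simple k) (fun x y => x + y)) (fun x y => |x - y|))
      (ha.map₂ hb (fun x y => x + y)) (fun ω => by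
        have e : s n ω + t n ω - (s k ω + t k ω) = (s n ω - s k ω) + (t n ω - t k ω) := by ring
        rw [e]
        exact abs_add_le _ _)
    rw [simpleIntegral_add m ha hb] at h3
    linarith

theorem HasIntegral.add {m : SetFunction Ω} (hm : m ∈ Prob Ω) {f g : Ω → ℝ} {I J : ℝ}
    (hf : HasIntegral m f I) (hg : HasIntegral m g J) :
    HasIntegral m (fun ω => f ω + g ω) (I + J) := by
  obtain ⟨s, hs, hsI⟩ := hf
  obtain ⟨t, ht, htJ⟩ := hg
  refine ⟨_, hs.add hm ht, ?_⟩
  simp_rw [simpleIntegral_add m (hs.simple _) (ht.simple _)]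
  exact hsI.add htJ

theorem HasIntegral.const_mul {m : SetFunction Ω} (hm : m ∈ Prob Ω) {f : Ω → ℝ} {I : ℝ}
    (hf : HasIntegral m f I) (c : ℝ) : HasIntegral m (fun ω => c * f ω) (c * I) := by
  obtain ⟨s, hs, hsI⟩ := hf
  -- The bound `|c| + 1` replaces `|c|` so that `c = 0` needs no separate case.
  have hc : 0 < |c| + 1 := by positivity
  refine ⟨fun n ω => c * s n ω, ⟨fun n => (hs.simple n).map _, ?_, fun ε hε => ?_⟩, ?_⟩
  · refine TendstoInProb.of_le hm (fun ε n => m {ω | ε / (|c| + 1) < |f ω - s n ω|})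
      (fun ε hε => hs.tendsto _ (div_pos hε hc))
      (fun ε hε => Eventually.of_forall fun n => prob_mono hm fun ω hω => ?_)
    simp only [Set.mem_ofPred_eq, ← mul_sub, abs_mul] at hω ⊢
    rw [div_lt_iff₀ hc]
    nlinarith [abs_nonneg (f ω - s n ω)]
  · obtain ⟨N, hN⟩ := hs.cauchy (ε / (|c| + 1)) (div_pos hε hc)
    refine ⟨N, fun n hn k hk => ?_⟩
    have h := hN n hn k hk
    rw [lt_div_iff₀ hc] at h
    have hd := (hs.simple n).map₂ (hs.simple k) (fun x y => |x - y|)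
    have h0 := simpleIntegral_mono hm (Set.finite_range_const (c := (0 : ℝ))) hd
      (fun ω => abs_nonneg _)
    rw [simpleIntegral_const hm] at h0
    simp only [← mul_sub, abs_mul]
    rw [simpleIntegral_const_mul m hd]
    linarith
  · simp_rw [simpleIntegral_const_mul m (hs.simple _)]
    exact hsI.const_mul c

theorem HasIntegral.sub {m : SetFunction Ω} (hm : m ∈ Prob Ω) {f g : Ω → ℝ} {I J : ℝ}
    (hf : HasIntegral m f I) (hg : HasIntegral m g J) :
    HasIntegral m (fun ω => f ω - g ω) (I - J) := by
  simpa [sub_eq_add_neg] using hf.add hm (hg.const_mul hm (-1))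

theorem HasIntegral.const {m : SetFunction Ω} (hm : m ∈ Prob Ω) (c : ℝ) :
    HasIntegral m (fun _ => c) c := by
  refine ⟨fun _ _ => c, ⟨fun _ => Set.finite_range_const, fun ε hε => ?_, fun ε hε => ⟨0, ?_⟩⟩, ?_⟩
  · simp [hε.not_gt]
  · intro n _ k _
    simpa [simpleIntegral_const hm] using hε
  · simp [simpleIntegral_const hm]

/-- The limit function enters only through convergence in measure, where an `m`-null perturbation is
invisible. Nullity is asked level by level: under finite additivity this is weaker than `m {g ≠ f} =
0`. -/
theorem IsDetermining.congr {m : SetFunction Ω} (hm : m ∈ Prob Ω) {s : ℕ → Ω → ℝ} {f g : Ω → ℝ}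
    (hs : IsDetermining m s f) (h : ∀ ε, 0 < ε → m {ω | ε < |g ω - f ω|} = 0) :
    IsDetermining m s g where
  simple := hs.simple
  cauchy := hs.cauchy
  tendsto := by
    refine TendstoInProb.of_le hm
      (fun ε n => m {ω | ε / 2 < |f ω - s n ω|} + m {ω | ε / 2 < |g ω - f ω|})
      (fun ε hε => by
        simpa [h (ε / 2) (half_pos hε)] using hs.tendsto (ε / 2) (half_pos hε))
      (fun ε hε => Eventually.of_forall fun n => prob_le_of_subset_union hm fun ω hω => ?_)
    by_contra hn
    simp only [Set.mem_union, Set.mem_ofPred_eq, not_or, not_lt] at hn hω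
    have := abs_sub_le (g ω) (f ω) (s n ω)
    linarith [hn.1, hn.2]

theorem IsDetermining.posPart {m : SetFunction Ω} (hm : m ∈ Prob Ω) {s : ℕ → Ω → ℝ} {f : Ω → ℝ}
    (hs : IsDetermining m s f) :
    IsDetermining m (fun n ω => max (s n ω) 0) (fun ω => max (f ω) 0) where
  simple n := (hs.simple n).map (max · 0)
  tendsto := TendstoInProb.of_le hm (fun ε n => m {ω | ε < |f ω - s n ω|}) hs.tendsto
    fun _ _ => Eventually.of_forall fun n => prob_mono hm fun ω hω =>
      lt_of_lt_of_le (id hω : _ < |_|) (abs_max_sub_max_le_abs (f ω) (s n ω) 0)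
  cauchy ε hε := by
    obtain ⟨N, hN⟩ := hs.cauchy ε hε
    refine ⟨N, fun n hn k hk => (simpleIntegral_mono hm ?_ ?_ ?_).trans_lt (hN n hn k hk)⟩
    · exact (hs.simple n).map₂ (hs.simple k) (fun x y => |max x 0 - max y 0|)
    · exact (hs.simple n).map₂ (hs.simple k) (fun x y => |x - y|)
    · exact fun ω => abs_max_sub_max_le_abs _ _ _

/-- The positive parts of a determining sequence determine the positive part of `f`, hence `f`
itself, and uniqueness of the integral does the rest. The set `{f < 0}` itself may have positive
mass even when every `{f < -ε}` is null. -/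
theorem HasIntegral.nonneg {m : SetFunction Ω} (hm : m ∈ Prob Ω) {f : Ω → ℝ} {I : ℝ}
    (hf : HasIntegral m f I) (h : ∀ ε, 0 < ε → m {ω | f ω < -ε} = 0) : 0 ≤ I := by
  obtain ⟨s, hs, hsI⟩ := hf
  have hd : IsDetermining m (fun n ω => max (s n ω) 0) f := by
    refine (hs.posPart hm).congr hm fun ε hε => le_antisymm ?_ (hm.1 _)
    refine (prob_mono hm fun ω hω => ?_).trans_eq (h ε hε)
    simp only [Set.mem_ofPred_eq] at hω ⊢
    rcases le_total 0 (f ω) with h0 | h0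
    · simp [max_eq_left h0, hε.not_gt] at hω
    · rw [max_eq_right h0, sub_zero, abs_of_nonpos h0] at hω
      linarith
  have hJ := Integrable.hasIntegral hm ⟨_, hd⟩
  have hI : I = integral m f := HasIntegral.unique hm ⟨s, hs, hsI⟩ hJ
  obtain ⟨J, hJ⟩ : ∃ J, Tendsto (fun n => simpleIntegral m (fun ω => max (s n ω) 0)) atTop
      (𝓝 J) := by
    refine cauchySeq_tendsto_of_complete (Metric.cauchySeq_iff.mpr fun ε hε => ?_)
    obtain ⟨N, hN⟩ := hd.cauchy ε hε
    exact ⟨N, fun n hn k hk =>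
      (abs_simpleIntegral_sub_le hm (hd.simple n) (hd.simple k)).trans_lt (hN n hn k hk)⟩
  rw [HasIntegral.unique hm ⟨s, hs, hsI⟩ ⟨_, hd, hJ⟩]
  refine ge_of_tendsto' hJ fun n => ?_
  exact (simpleIntegral_const hm 0).symm.trans_le
    (simpleIntegral_mono hm Set.finite_range_const (hd.simple n) fun ω => le_max_right _ _)

theorem HasIntegral.mono {m : SetFunction Ω} (hm : m ∈ Prob Ω) {f g : Ω → ℝ} {I J : ℝ}
    (hf : HasIntegral m f I) (hg : HasIntegral m g J)
    (h : ∀ ε, 0 < ε → m {ω | g ω - f ω < -ε} = 0) : I ≤ J :=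
  sub_nonneg.mp ((hg.sub hm hf).nonneg hm h)

theorem HasIntegral.integral_eq {m : SetFunction Ω} (hm : m ∈ Prob Ω) {f : Ω → ℝ} {I : ℝ}
    (hf : HasIntegral m f I) : integral m f = I :=
  HasIntegral.unique hm (Integrable.hasIntegral hm (hf.imp fun _ h => h.1)) hf

theorem Integrable.sub {m : SetFunction Ω} (hm : m ∈ Prob Ω) {f g : Ω → ℝ}
    (hf : Integrable m f) (hg : Integrable m g) : Integrable m (fun ω => f ω - g ω) :=
  ((hf.hasIntegral hm).sub hm (hg.hasIntegral hm)).imp fun _ h => h.1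

end FinAdd

/-! ### Finitely additive probabilities induced by positive linear functionals. -/

namespace FinAdd

variable {Ω : Type*}

open Classical in
/-- The set function `A ↦ φ 1_A` of a linear functional `φ`. -/
noncomputable def ofFunctional (φ : (Ω → ℝ) →ₗ[ℝ] ℝ) : SetFunction Ω :=
  MeasureTheory.IsSetRing.addContent_of_union (fun A => φ (A.indicator 1))
    ⟨trivial, fun _ _ _ _ => trivial, fun _ _ _ _ => trivial⟩ (by rw [Set.indicator_empty]; exact map_zero φ) fun {s t} _ _ h => by
      rw [Set.indicator_union_of_disjoint h, ← map_add]
      rfl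

theorem ofFunctional_apply (φ : (Ω → ℝ) →ₗ[ℝ] ℝ) (A : Set Ω) :
    ofFunctional φ A = φ (A.indicator 1) := rfl

theorem simpleIntegral_ofFunctional (φ : (Ω → ℝ) →ₗ[ℝ] ℝ) {s : Ω → ℝ} (hs : IsSimple s) :
    simpleIntegral (ofFunctional φ) s = φ s := by
  classical
  have hfin : s = ∑ y ∈ hs.toFinset, y • (s ⁻¹' {y}).indicator 1 := by
    ext ω
    rw [Finset.sum_apply, Finset.sum_eq_single (s ω)]
    · simp
    · intro y _ hy
      simp [Set.indicator_of_notMem, hy.symm]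
    · intro h
      exact absurd (hs.mem_toFinset.mpr ⟨ω, rfl⟩) h
  unfold simpleIntegral
  rw [finsum_eq_sum_of_support_subset (s := hs.toFinset)]
  · conv_rhs => rw [hfin, map_sum]
    refine Finset.sum_congr rfl fun y _ => ?_
    rw [map_smul, ofFunctional_apply, smul_eq_mul, mul_comm]
  · intro y hy
    by_contra hn
    apply hy
    have : s ⁻¹' {y} = ∅ := by
      rw [Set.preimage_singleton_eq_empty]
      exact fun hy => hn (hs.mem_toFinset.mpr hy)
    simp [this]

/-- A normalized linear functional that is positive on a solid subspace `L` containing `1`. -/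
structure IsPositiveOn (L : Set (Ω → ℝ)) (φ : (Ω → ℝ) →ₗ[ℝ] ℝ) : Prop where
  solid : ∀ f ∈ L, ∀ g : Ω → ℝ, (∀ ω, |g ω| ≤ |f ω|) → g ∈ L
  bounded_mem : ∀ (K : ℝ) (g : Ω → ℝ), (∀ ω, |g ω| ≤ K) → g ∈ L
  nonneg : ∀ f ∈ L, (∀ ω, 0 ≤ f ω) → 0 ≤ φ f
  one : φ 1 = 1

namespace IsPositiveOn

variable {L : Set (Ω → ℝ)} {φ : (Ω → ℝ) →ₗ[ℝ] ℝ}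

theorem const (h : IsPositiveOn L φ) (c : ℝ) : φ (fun _ => c) = c := by
  have : (fun _ => c : Ω → ℝ) = c • 1 := by ext; simp
  rw [this, map_smul, h.one, smul_eq_mul, mul_one]

theorem indicator_mem (h : IsPositiveOn L φ) (A : Set Ω) : A.indicator 1 ∈ L := by
  classical
  refine h.bounded_mem 1 _ fun ω => ?_
  by_cases hω : ω ∈ A <;> simp [hω]

theorem prob (h : IsPositiveOn L φ) : ofFunctional φ ∈ Prob Ω := by
  refine ⟨fun A => h.nonneg _ (h.indicator_mem A) fun ω => ?_, ?_⟩
  · exact Set.indicator_nonneg (fun _ _ => zero_le_one) ω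
  · rw [ofFunctional_apply, Set.indicator_univ, h.one]

/-- Monotonicity for functions between `0` and an element of `L`. -/
theorem mono_of_nonneg (h : IsPositiveOn L φ) {f g : Ω → ℝ} (hg : g ∈ L) (h0 : ∀ ω, 0 ≤ f ω)
    (hfg : ∀ ω, f ω ≤ g ω) : φ f ≤ φ g := by
  have := h.nonneg (g - f) (h.solid g hg _ fun ω => ?_) fun ω => sub_nonneg.mpr (hfg ω)
  · rw [map_sub] at this
    linarith
  · have := h0 ω
    have := hfg ω
    rw [Pi.sub_apply, abs_of_nonneg (by linarith), abs_of_nonneg (by linarith)]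
    linarith

/-- Positivity applied to the bounded functions `K + f` and `K - f`. -/
theorem abs_le_of_bounded (h : IsPositiveOn L φ) {f : Ω → ℝ} {K : ℝ} (hf : ∀ ω, |f ω| ≤ K) :
    |φ f| ≤ K := by
  have hmem : ∀ σ : ℝ, |σ| = 1 → (fun ω => K + σ * f ω) ∈ L ∧ ∀ ω, 0 ≤ K + σ * f ω := by
    intro σ hσ
    have hσf : ∀ ω, |σ * f ω| ≤ K := fun ω => by rw [abs_mul, hσ, one_mul]; exact hf ω
    have h0 : ∀ ω, 0 ≤ K + σ * f ω := fun ω => by linarith [(abs_le.mp (hσf ω)).1]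
    refine ⟨h.bounded_mem (2 * K) _ fun ω => ?_, h0⟩
    rw [abs_of_nonneg (h0 ω)]
    linarith [(abs_le.mp (hσf ω)).2]
  have hval : ∀ σ : ℝ, |σ| = 1 → 0 ≤ K + σ * φ f := by
    intro σ hσ
    have h1 := h.nonneg _ (hmem σ hσ).1 (hmem σ hσ).2
    have e : (fun ω => K + σ * f ω) = (fun _ => K) + σ • f := by ext; simp
    rwa [e, map_add, h.const, map_smul, smul_eq_mul] at h1
  have h1 := hval 1 (by simp)
  have h2 := hval (-1) (by simp)
  rw [abs_le]
  constructor <;> linarith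

/-- The truncation of `f` at level `n`, rounded down to the grid of mesh `1 / (n + 1)`. -/
noncomputable def approx (f : Ω → ℝ) (n : ℕ) (ω : Ω) : ℝ :=
  (⌊(n + 1 : ℝ) * min (f ω) n⌋ : ℝ) / (n + 1)

theorem approx_close (f : Ω → ℝ) (n : ℕ) (ω : Ω) :
    |min (f ω) n - approx f n ω| ≤ 1 / (n + 1 : ℝ) := by
  have hn : (0 : ℝ) < n + 1 := by positivity
  have h1 := Int.floor_le ((n + 1 : ℝ) * min (f ω) n)
  have h2 := Int.lt_floor_add_one ((n + 1 : ℝ) * min (f ω) n)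
  have e : min (f ω) n - approx f n ω =
      ((n + 1 : ℝ) * min (f ω) n - ⌊(n + 1 : ℝ) * min (f ω) n⌋) / (n + 1) := by
    unfold approx
    field_simp
  rw [e, abs_of_nonneg (div_nonneg (by linarith) hn.le)]
  gcongr
  linarith

theorem approx_simple {f : Ω → ℝ} (hf : ∀ ω, 0 ≤ f ω) (n : ℕ) : IsSimple (approx f n) := by
  have hn : (0 : ℝ) < n + 1 := by positivity
  refine ((Set.finite_Icc (0 : ℤ) ⌊(n + 1 : ℝ) * n⌋).image
    (fun k : ℤ => (k : ℝ) / (n + 1))).subset ?_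
  rintro _ ⟨ω, rfl⟩
  refine ⟨_, ⟨Int.floor_nonneg.mpr ?_, Int.floor_le_floor ?_⟩, rfl⟩
  · exact mul_nonneg hn.le (le_min (hf ω) n.cast_nonneg)
  · exact mul_le_mul_of_nonneg_left (min_le_right _ _) hn.le

/-- The numbers `φ(f ∧ n)` increase and are bounded by `φ f`; their limit is the integral. The
inequality can be strict, since `φ` need not be continuous along truncations, but for bounded `f`
the truncations are eventually `f` itself. -/
theorem exists_hasIntegral_of_nonneg (h : IsPositiveOn L φ) {f : Ω → ℝ} (hf : f ∈ L)
    (h0 : ∀ ω, 0 ≤ f ω) : ∃ I ≤ φ f, HasIntegral (ofFunctional φ) f I ∧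
      ((∃ K, ∀ ω, f ω ≤ K) → I = φ f) := by
  have htr0 : ∀ n : ℕ, ∀ ω, 0 ≤ min (f ω) n := fun n ω => le_min (h0 ω) n.cast_nonneg
  set T : ℕ → Ω → ℝ := fun n ω => min (f ω) n with hT
  have hTL : ∀ n, T n ∈ L := fun n => h.solid f hf _ fun ω => by
    rw [abs_of_nonneg (htr0 n ω), abs_of_nonneg (h0 ω)]
    exact min_le_left _ _
  have hTm : ∀ {n k : ℕ}, n ≤ k → ∀ ω, T n ω ≤ T k ω := fun hnk ω =>
    min_le_min le_rfl (Nat.cast_le.mpr hnk)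
  have hmono : Monotone (fun n => φ (T n)) := fun n k hnk =>
    h.mono_of_nonneg (hTL k) (htr0 n) (hTm hnk)
  have hle : ∀ n, φ (T n) ≤ φ f := fun n =>
    h.mono_of_nonneg hf (htr0 n) fun ω => min_le_left _ _
  obtain ⟨I, hI⟩ : ∃ I, Tendsto (fun n => φ (T n)) atTop (𝓝 I) :=
    ⟨_, tendsto_atTop_ciSup hmono ⟨φ f, by rintro _ ⟨n, rfl⟩; exact hle n⟩⟩
  have hinv : Tendsto (fun n : ℕ => 1 / ((n : ℝ) + 1)) atTop (𝓝 0) :=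
    tendsto_one_div_add_atTop_nhds_zero_nat
  have hclose : ∀ n, |φ (T n) - φ (approx f n)| ≤ 1 / (n + 1 : ℝ) := fun n => by
    rw [← map_sub]
    exact h.abs_le_of_bounded (approx_close f n)
  refine ⟨I, le_of_tendsto' hI hle, ⟨approx f, ⟨approx_simple h0, ?_, ?_⟩, ?_⟩, ?_⟩
  -- Once the mesh is below `ε`, the error can exceed `ε` only on `{f > n}`. Chebyshev bounds its
  -- mass by `φ f / n`, and `1 / n ≤ 2 / (n + 1)` for `n ≥ 1`.
  · refine TendstoInProb.of_le h.prob (fun _ n => φ f * (1 / ((n : ℝ) + 1)) * 2)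
      (fun _ _ => by simpa using (hinv.const_mul (φ f)).mul_const 2) fun ε hε => ?_
    filter_upwards [hinv.eventually (gt_mem_nhds hε), eventually_ge_atTop 1] with n hn hn1
    have hn0 : (0 : ℝ) < n := by exact_mod_cast hn1
    set A : Set Ω := {ω | (n : ℝ) < f ω}
    have hA : φ (A.indicator 1) ≤ φ f * (1 / ((n : ℝ) + 1)) * 2 := by
      have h1 : φ (A.indicator 1) * n ≤ φ f := by
        rw [mul_comm, ← smul_eq_mul, ← map_smul]
        refine h.mono_of_nonneg hf (fun ω => ?_) fun ω => ?_
        · exact mul_nonneg hn0.le (Set.indicator_nonneg (fun _ _ => zero_le_one) ω)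
        · classical
          by_cases hω : ω ∈ A
          · simpa [hω] using (show (n : ℝ) < f ω from hω).le
          · simpa [hω] using h0 ω
      have h2 : 0 ≤ φ (A.indicator 1) := h.prob.1 A
      have h3 : (1 : ℝ) ≤ n := by exact_mod_cast hn1
      rw [mul_one_div, div_mul_eq_mul_div, le_div_iff₀ (by positivity)]
      nlinarith
    refine (prob_mono h.prob fun ω hω => ?_).trans hA
    by_contra hω'
    have h1 : f ω ≤ n := not_lt.mp hω'
    have h2 := approx_close f n ω
    rw [min_eq_left h1] at h2
    exact (lt_of_lt_of_le (show ε < |f ω - approx f n ω| from hω) h2).not_gt hn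
  · intro ε hε
    obtain ⟨N₁, hN₁⟩ := Metric.cauchySeq_iff.mp hI.cauchySeq (ε / 3) (by linarith)
    obtain ⟨N₂, hN₂⟩ := eventually_atTop.mp
      (hinv.eventually (gt_mem_nhds (show 0 < ε / 3 by linarith)))
    refine ⟨max N₁ N₂, fun n hn k hk => ?_⟩
    wlog hnk : n ≤ k generalizing n k
    · simpa only [abs_sub_comm] using this k hk n hn (le_of_not_ge hnk)
    have hn2 := hN₂ n ((le_max_right _ _).trans hn)
    have hk2 := hN₂ k ((le_max_right _ _).trans hk)
    have hd := hN₁ k ((le_max_left _ _).trans hk) n ((le_max_left _ _).trans hn)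
    rw [Real.dist_eq, abs_of_nonneg (sub_nonneg.mpr (hmono hnk))] at hd
    have hs : IsSimple (fun ω => |approx f n ω - approx f k ω|) :=
      (approx_simple h0 n).map₂ (approx_simple h0 k) (fun x y => |x - y|)
    rw [simpleIntegral_ofFunctional φ hs]
    -- For `n ≤ k` the distance between the approximants is at most `T k - T n` plus the two meshes,
    -- and `φ (T k) - φ (T n)` is small because `φ (T n)` converges.
    set c : ℝ := 1 / ((n : ℝ) + 1) + 1 / ((k : ℝ) + 1)
    have hb : φ (fun ω => |approx f n ω - approx f k ω|) ≤ φ (T k - T n + fun _ => c) := by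
      have hc : 0 ≤ c := by positivity
      refine h.mono_of_nonneg (h.bounded_mem (k + c) _ fun ω => ?_) (fun ω => abs_nonneg _)
        fun ω => ?_
      · have h1 := hTm hnk ω
        have h2 := htr0 n ω
        have h3 : T k ω ≤ k := min_le_right _ _
        have h4 : 0 ≤ T n ω := h2
        simp only [Pi.add_apply, Pi.sub_apply]
        rw [abs_of_nonneg (by linarith)]
        linarith
      · have h1 := hTm hnk ω
        have h2 := abs_le.mp (approx_close f n ω)
        have h3 := abs_le.mp (approx_close f k ω)
        simp only [Pi.add_apply, Pi.sub_apply, hT, c] at h1 ⊢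
        rw [abs_le]
        constructor <;> linarith [h2.1, h2.2, h3.1, h3.2]
    rw [map_add, map_sub, h.const] at hb
    simp only [c] at hb
    linarith
  · simp_rw [simpleIntegral_ofFunctional φ (approx_simple h0 _)]
    have h1 : Tendsto (fun n => φ (T n) - φ (approx f n)) atTop (𝓝 0) :=
      squeeze_zero_norm hclose hinv
    simpa using hI.sub h1
  · rintro ⟨K, hK⟩
    refine tendsto_nhds_unique hI (tendsto_const_nhds.congr' ?_)
    filter_upwards [eventually_ge_atTop ⌈K⌉₊] with n hn
    congr 1
    ext ω
    exact (min_eq_left ((hK ω).trans ((Nat.le_ceil K).trans (Nat.cast_le.mpr hn)))).symm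

theorem posPart_mem (h : IsPositiveOn L φ) {f : Ω → ℝ} (hf : f ∈ L) :
    (fun ω => max (f ω) 0) ∈ L :=
  h.solid f hf _ fun ω => by
    rw [abs_of_nonneg (le_max_right _ _)]
    exact max_le (le_abs_self _) (abs_nonneg _)

theorem negPart_mem (h : IsPositiveOn L φ) {f : Ω → ℝ} (hf : f ∈ L) :
    (fun ω => max (-f ω) 0) ∈ L :=
  h.solid f hf _ fun ω => by
    rw [abs_of_nonneg (le_max_right _ _)]
    exact max_le (neg_le_abs _) (abs_nonneg _)

theorem posPart_sub_negPart (f : Ω → ℝ) : (fun ω => max (f ω) 0 - max (-f ω) 0) = f := by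
  ext ω
  rcases le_total 0 (f ω) with h0 | h0
  · rw [max_eq_left h0, max_eq_right (by linarith), sub_zero]
  · rw [max_eq_right h0, max_eq_left (by linarith)]
    ring

theorem integrable (h : IsPositiveOn L φ) {f : Ω → ℝ} (hf : f ∈ L) :
    Integrable (ofFunctional φ) f := by
  obtain ⟨I, -, ⟨s, hs, -⟩, -⟩ :=
    h.exists_hasIntegral_of_nonneg (h.posPart_mem hf) (fun ω => le_max_right _ _)
  obtain ⟨J, -, ⟨t, ht, -⟩, -⟩ :=
    h.exists_hasIntegral_of_nonneg (h.negPart_mem hf) (fun ω => le_max_right _ _)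
  have := Integrable.sub h.prob ⟨s, hs⟩ ⟨t, ht⟩
  rwa [posPart_sub_negPart] at this

/-- The integral is dominated by `φ` on functions with a `φ`-null negative part, with equality for
those that are bounded above. -/
theorem exists_hasIntegral_of_negPart (h : IsPositiveOn L φ) {f : Ω → ℝ} (hf : f ∈ L)
    (h0 : φ (fun ω => max (-f ω) 0) ≤ 0) : ∃ I ≤ φ f, HasIntegral (ofFunctional φ) f I ∧
      ((∃ K, ∀ ω, f ω ≤ K) → I = φ f) := by
  obtain ⟨I, hI, hfI, hbI⟩ :=
    h.exists_hasIntegral_of_nonneg (h.posPart_mem hf) (fun ω => le_max_right _ _)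
  obtain ⟨J, hJ, hfJ, -⟩ :=
    h.exists_hasIntegral_of_nonneg (h.negPart_mem hf) (fun ω => le_max_right _ _)
  have hJ0 : 0 ≤ J := hfJ.nonneg h.prob fun ε hε => by
    have : {ω | max (-f ω) 0 < -ε} = ∅ := by
      ext ω
      simp [hε.le]
    rw [this, MeasureTheory.addContent_empty]
  have hφ : φ f = φ (fun ω => max (f ω) 0) - φ (fun ω => max (-f ω) 0) := by
    rw [← map_sub]
    exact congrArg φ (posPart_sub_negPart f).symm
  have hsub := hfI.sub h.prob hfJ
  rw [posPart_sub_negPart] at hsub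
  refine ⟨I - J, by linarith, hsub, fun ⟨K, hK⟩ => ?_⟩
  rw [hbI ⟨max K 0, fun ω => max_le_max (hK ω) le_rfl⟩]
  linarith

end IsPositiveOn

end FinAdd

/-! ### The order, the complete market and the superhedging cone. -/

namespace Economy

variable {Ω : Type*} {ge : (Ω → ℝ) → (Ω → ℝ) → Prop} {𝒳 : Set (Ω → ℝ)} {π : (Ω → ℝ) → ℝ}

namespace IsCommonOrder

theorem add_right (h : IsCommonOrder ge) {f g : Ω → ℝ} (hfg : ge f g) (k : Ω → ℝ) :
    ge (f + k) (g + k) := by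
  simpa using h.affine f g 1 k hfg zero_le_one ⟨1, fun _ => le_rfl⟩

theorem add (h : IsCommonOrder ge) {f g f' g' : Ω → ℝ} (hfg : ge f g) (hfg' : ge f' g') :
    ge (f + f') (g + g') := by
  refine h.trans _ _ _ (h.add_right hfg f') ?_
  rw [add_comm g, add_comm g]
  exact h.add_right hfg' g

theorem sub_nonneg (h : IsCommonOrder ge) {f g : Ω → ℝ} (hfg : ge f g) : ge (f - g) 0 := by
  simpa [sub_eq_add_neg] using h.add_right hfg (-g)

theorem smul (h : IsCommonOrder ge) {f g : Ω → ℝ} (hfg : ge f g) {c : ℝ} (hc : 0 ≤ c) :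
    ge (c • f) (c • g) := by
  have := h.affine f g (fun _ => c) 0 hfg (fun _ => hc) ⟨c, fun _ => le_rfl⟩
  rw [add_zero, add_zero] at this
  exact this

/-- Multiplying `f ≥_* 0` by the indicator of `{f < 0}` leaves `-f⁻ ≥_* 0`; adding `f⁻` to both
sides concludes. -/
theorem negPart (h : IsCommonOrder ge) {f : Ω → ℝ} (hf : ge f 0) :
    ge 0 (fun ω => max (-f ω) 0) := by
  classical
  have h1 := h.affine f 0 ({ω | f ω < 0}.indicator 1) (fun ω => max (-f ω) 0) hf
    (fun ω => Set.indicator_nonneg (fun _ _ => zero_le_one) ω)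
    ⟨1, fun ω => Set.indicator_le_self' (fun _ _ => zero_le_one) ω⟩
  have e : {ω | f ω < 0}.indicator 1 * f + (fun ω => max (-f ω) 0) = 0 := by
    ext ω
    by_cases hω : f ω < 0
    · simp [hω, max_eq_left (neg_nonneg.mpr hω.le)]
    · simp [hω, not_lt.mp hω]
  rwa [e, mul_zero, zero_add] at h1

/-- Chebyshev for the order: `1_{f < -ε} ≤ ε⁻¹ f⁻`, and `0 ≥_* f⁻`. -/
theorem negligible_of_nonneg (h : IsCommonOrder ge) {f : Ω → ℝ} (hf : ge f 0) {ε : ℝ}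
    (hε : 0 < ε) : {ω | f ω < -ε} ∈ Negligible ge := by
  classical
  have h1 := h.smul (h.negPart hf) (inv_pos.mpr hε).le
  rw [smul_zero] at h1
  refine h.trans _ _ _ h1 (h.of_le _ _ fun ω => ?_)
  by_cases hω : f ω < -ε
  · simp only [Pi.smul_apply, smul_eq_mul]
    rw [Set.indicator_of_mem (show ω ∈ {ω | f ω < -ε} from hω), Pi.one_apply,
      inv_mul_eq_div, le_div_iff₀ hε, one_mul]
    exact le_max_of_le_left (by linarith)
  · rw [Set.indicator_of_notMem (show ω ∉ {ω | f ω < -ε} from hω)]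
    exact mul_nonneg (inv_pos.mpr hε).le (le_max_right _ _)

/-- Pointwise `|f ∧ 1| ≤ 1 + 2 f⁻`, and the last term is dominated by `0`. -/
theorem one_ge_abs_trunc (h : IsCommonOrder ge) {f : Ω → ℝ} (hf : ge f 0) : ge 1 |f ⊓ 1| := by
  have h1 := h.add_right (h.smul (h.negPart hf) (zero_le_two (α := ℝ))) (1 : Ω → ℝ)
  rw [smul_zero, zero_add] at h1
  refine h.trans _ _ _ h1 (h.of_le _ _ fun ω => ?_)
  simp only [Pi.abs_apply, Pi.inf_apply, Pi.add_apply, Pi.smul_apply, smul_eq_mul, Pi.one_apply]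
  have h2 := le_max_left (-f ω) 0
  have h3 := le_max_right (-f ω) 0
  rcases min_cases (f ω) 1 with ⟨e, h4⟩ | ⟨e, h4⟩ <;> rw [e, abs_le] <;> constructor <;> linarith

end IsCommonOrder

namespace IsMarket

theorem smul_mem (hM : IsMarket ge 𝒳 π) {X : Ω → ℝ} (hX : X ∈ 𝒳) {a : ℝ} (h0 : 0 ≤ a)
    (h1 : a ≤ 1) : a • X ∈ 𝒳 := by
  simpa using hM.convex hX hM.zero_mem h0 (sub_nonneg.mpr h1) (by ring)

theorem price_zero (hM : IsMarket ge 𝒳 π) : π 0 = 0 := by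
  have := hM.price.pos_homogeneous 2 two_pos 0 hM.zero_mem (by simpa using hM.zero_mem)
  rw [smul_zero] at this
  linarith

/-- Positive combinations of payoffs, rescaled to lie in the convex set `𝒳`. -/
theorem exists_combination (hM : IsMarket ge 𝒳 π) {X Y : Ω → ℝ} (hX : X ∈ 𝒳) (hY : Y ∈ 𝒳)
    {a b : ℝ} (ha : 0 < a) (hb : 0 < b) :
    ∃ Z ∈ 𝒳, (a + b) • Z = a • X + b • Y ∧ (a + b) * π Z ≤ a * π X + b * π Y := by
  have hab : 0 < a + b := add_pos ha hb
  have hsum : a / (a + b) + b / (a + b) = 1 := by rw [← add_div, div_self hab.ne']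
  have hpa : 0 < a / (a + b) := div_pos ha hab
  have hpb : 0 < b / (a + b) := div_pos hb hab
  have hXa := hM.smul_mem hX hpa.le (by linarith)
  have hYb := hM.smul_mem hY hpb.le (by linarith)
  have hZ := hM.convex hX hY hpa.le hpb.le hsum
  refine ⟨_, hZ, ?_, ?_⟩
  · rw [smul_add, smul_smul, smul_smul, mul_div_cancel₀ _ hab.ne', mul_div_cancel₀ _ hab.ne']
  · have h1 := hM.price.subadditive _ hXa _ hYb hZ
    rw [hM.price.pos_homogeneous _ hpa _ hX hXa, hM.price.pos_homogeneous _ hpb _ hY hYb] at h1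
    refine (mul_le_mul_of_nonneg_left h1 hab.le).trans_eq ?_
    field_simp

theorem mem_completeMarket_of_ge (hM : IsMarket ge 𝒳 π) {f g : Ω → ℝ}
    (hf : f ∈ completeMarket ge 𝒳) (hfg : ge |f| |g|) : g ∈ completeMarket ge 𝒳 := by
  obtain ⟨c, hc, X, hX, h⟩ := hf
  exact ⟨c, hc, X, hX, hM.order.trans _ _ _ h hfg⟩

theorem one_mem_completeMarket (hM : IsMarket ge 𝒳 π) : 1 ∈ completeMarket ge 𝒳 :=
  ⟨1, one_pos, 1, hM.one_mem, hM.order.of_le _ _ fun ω => by simp⟩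

theorem add_mem_completeMarket (hM : IsMarket ge 𝒳 π) {f g : Ω → ℝ}
    (hf : f ∈ completeMarket ge 𝒳) (hg : g ∈ completeMarket ge 𝒳) :
    f + g ∈ completeMarket ge 𝒳 := by
  obtain ⟨a, ha, X, hX, hf⟩ := hf
  obtain ⟨b, hb, Y, hY, hg⟩ := hg
  obtain ⟨Z, hZ, hZe, -⟩ := hM.exists_combination hX hY ha hb
  refine ⟨a + b, add_pos ha hb, Z, hZ, ?_⟩
  rw [hZe]
  exact hM.order.trans _ _ _ (hM.order.add hf hg) (hM.order.of_le _ _ (abs_add_le f g))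

theorem smul_mem_completeMarket (hM : IsMarket ge 𝒳 π) {f : Ω → ℝ}
    (hf : f ∈ completeMarket ge 𝒳) (c : ℝ) : c • f ∈ completeMarket ge 𝒳 := by
  obtain ⟨a, ha, X, hX, hf⟩ := hf
  have hc : 0 < |c| + 1 := by positivity
  refine ⟨(|c| + 1) * a, mul_pos hc ha, X, hX, ?_⟩
  rw [mul_smul]
  refine hM.order.trans _ _ _ (hM.order.smul hf hc.le) (hM.order.of_le _ _ fun ω => ?_)
  simp only [Pi.abs_apply, Pi.smul_apply, smul_eq_mul, abs_mul]
  nlinarith [abs_nonneg (f ω)]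

/-- The complete market as a linear subspace. -/
def completeSubmodule (hM : IsMarket ge 𝒳 π) : Submodule ℝ (Ω → ℝ) where
  carrier := completeMarket ge 𝒳
  add_mem' := hM.add_mem_completeMarket
  zero_mem' := by simpa using hM.smul_mem_completeMarket hM.one_mem_completeMarket 0
  smul_mem' c _ hf := hM.smul_mem_completeMarket hf c

theorem bounded_mem_completeMarket (hM : IsMarket ge 𝒳 π) (K : ℝ) (g : Ω → ℝ)
    (hg : ∀ ω, |g ω| ≤ K) : g ∈ completeMarket ge 𝒳 := by
  refine hM.mem_completeMarket_of_ge (hM.smul_mem_completeMarket hM.one_mem_completeMarket K)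
    (hM.order.of_le _ _ fun ω => ?_)
  simpa using (hg ω).trans (le_abs_self K)

theorem const_mem_completeMarket (hM : IsMarket ge 𝒳 π) (a : ℝ) :
    (fun _ => a : Ω → ℝ) ∈ completeMarket ge 𝒳 :=
  hM.bounded_mem_completeMarket |a| _ fun _ => le_rfl

/-- If `X ≥_* a`, then pointwise `|X| ≤ X + (|a| - a) + 2 (X - a)⁻`. The last term is dominated by
`0`, and adding the constant `|a| - a ≥ 0` stays within `𝒳`. -/
theorem subset_completeMarket (hM : IsMarket ge 𝒳 π) : 𝒳 ⊆ completeMarket ge 𝒳 := by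
  intro X hX
  obtain ⟨a, ha⟩ := hM.bounded_loss X hX
  refine ⟨1, one_pos, _, hM.add_const_mem X hX (|a| - a) (by linarith [le_abs_self a]), ?_⟩
  have h1 := hM.order.smul (hM.order.negPart (hM.order.sub_nonneg ha)) (zero_le_two (α := ℝ))
  have h2 := hM.order.add_right h1 (X + fun _ => |a| - a)
  rw [smul_zero, zero_add] at h2
  rw [one_smul]
  refine hM.order.trans _ _ _ h2 (hM.order.of_le _ _ fun ω => ?_)
  simp only [Pi.abs_apply, Pi.add_apply, Pi.sub_apply, Pi.smul_apply, smul_eq_mul]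
  have h3 := le_max_left (-(X ω - a)) 0
  have h4 := le_max_right (-(X ω - a)) 0
  rw [abs_le]
  constructor <;> linarith [le_abs_self a, neg_abs_le a]

theorem superhedgeCone_of_ge (hM : IsMarket ge 𝒳 π) {f g : Ω → ℝ}
    (hf : f ∈ superhedgeCone ge 𝒳 π) (hfg : ge f g) : g ∈ superhedgeCone ge 𝒳 π := by
  obtain ⟨c, hc, X, hX, h⟩ := hf
  exact ⟨c, hc, X, hX, hM.order.trans _ _ _ h hfg⟩

theorem superhedgeCone_add (hM : IsMarket ge 𝒳 π) {f g : Ω → ℝ}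
    (hf : f ∈ superhedgeCone ge 𝒳 π) (hg : g ∈ superhedgeCone ge 𝒳 π) :
    f + g ∈ superhedgeCone ge 𝒳 π := by
  obtain ⟨a, ha, X, hX, hf⟩ := hf
  obtain ⟨b, hb, Y, hY, hg⟩ := hg
  obtain ⟨Z, hZ, hZe, hZp⟩ := hM.exists_combination hX hY ha hb
  refine ⟨a + b, add_pos ha hb, Z, hZ,
    hM.order.trans _ _ _ (hM.order.of_le _ _ fun ω => ?_) (hM.order.add hf hg)⟩
  have := congrFun hZe ω
  simp only [Pi.add_apply, Pi.sub_apply, Pi.smul_apply, smul_eq_mul] at this ⊢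
  linarith

theorem superhedgeCone_smul (hM : IsMarket ge 𝒳 π) {f : Ω → ℝ}
    (hf : f ∈ superhedgeCone ge 𝒳 π) {c : ℝ} (hc : 0 < c) : c • f ∈ superhedgeCone ge 𝒳 π := by
  obtain ⟨a, ha, X, hX, hf⟩ := hf
  refine ⟨c * a, mul_pos hc ha, X, hX, ?_⟩
  rw [mul_smul]
  exact hM.order.smul hf hc.le

theorem sub_price_mem_superhedgeCone (hM : IsMarket ge 𝒳 π) {X : Ω → ℝ} (hX : X ∈ 𝒳) :
    (X - fun _ => π X) ∈ superhedgeCone ge 𝒳 π :=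
  ⟨1, one_pos, X, hX, by simpa using hM.order.refl _⟩

theorem zero_mem_superhedgeCone (hM : IsMarket ge 𝒳 π) : 0 ∈ superhedgeCone ge 𝒳 π := by
  have := hM.sub_price_mem_superhedgeCone hM.zero_mem
  rw [hM.price_zero] at this
  exact hM.superhedgeCone_of_ge this (hM.order.of_le _ _ fun ω => by simp)

end IsMarket

/-! ### The superhedging price: (a) implies (b). -/

theorem mem_uniformClosure_iff {A : Set (Ω → ℝ)} {f : Ω → ℝ} :
    f ∈ uniformClosure A ↔ ∀ ε : ℝ, 0 < ε → ∃ g ∈ A, ∀ ω, |f ω - g ω| < ε := by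
  unfold uniformClosure
  rw [Set.mem_ofPred_eq,
    mem_closure_iff_nhds_basis
      (UniformFun.hasBasis_nhds_of_basis Ω ℝ _ Metric.uniformity_basis_dist)]
  constructor
  · intro h ε hε
    obtain ⟨_, ⟨g, hg, rfl⟩, hd⟩ := h ε hε
    exact ⟨g, hg, fun ω => hd ω⟩
  · intro h ε hε
    obtain ⟨g, hg, hd⟩ := h ε hε
    exact ⟨_, ⟨g, hg, rfl⟩, fun ω => hd ω⟩

/-- The superhedging price: the least cash needed to superhedge `f`. -/
noncomputable def superhedgePrice (ge : (Ω → ℝ) → (Ω → ℝ) → Prop) (𝒳 : Set (Ω → ℝ))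
    (π : (Ω → ℝ) → ℝ) (f : Ω → ℝ) : ℝ :=
  sInf {a : ℝ | (f - fun _ => a) ∈ superhedgeCone ge 𝒳 π}

/-- No claim dominating a positive constant can be superhedged at zero cost. -/
def NoSureProfit (ge : (Ω → ℝ) → (Ω → ℝ) → Prop) (𝒳 : Set (Ω → ℝ)) (π : (Ω → ℝ) → ℝ) : Prop :=
  ∀ k : ℝ, (fun _ => k : Ω → ℝ) ∈ superhedgeCone ge 𝒳 π → k ≤ 0

namespace IsMarket

theorem noSureProfit (hM : IsMarket ge 𝒳 π)
    (ha : uniformClosure (superhedgeCone ge 𝒳 π) ∩ {f | Gt ge f 0} = ∅) :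
    NoSureProfit ge 𝒳 π := by
  intro k hk
  by_contra! hpos
  have h1 := hM.superhedgeCone_smul hk (inv_pos.mpr hpos)
  have e : (k⁻¹ • fun _ => k : Ω → ℝ) = 1 := by ext; simp [hpos.ne']
  rw [e] at h1
  refine Set.eq_empty_iff_forall_notMem.mp ha 1 ⟨?_, hM.order.one_gt_zero⟩
  exact mem_uniformClosure_iff.mpr fun ε hε => ⟨1, h1, fun ω => by simpa using hε⟩

theorem superhedge_nonempty (hM : IsMarket ge 𝒳 π) {f : Ω → ℝ}
    (hf : f ∈ completeMarket ge 𝒳) :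
    ∃ a : ℝ, (f - fun _ => a) ∈ superhedgeCone ge 𝒳 π := by
  obtain ⟨c, hc, X, hX, h⟩ := hf
  refine ⟨c * π X, c, hc, X, hX, ?_⟩
  have h1 := hM.order.add_right (hM.order.trans _ _ _ h (hM.order.of_le _ _ (le_abs_self f)))
    (fun _ => -(c * π X))
  convert h1 using 1 <;> ext ω <;> simp <;> ring

/-- If `b` superhedges `-f` and `a` superhedges `f`, the sum of the two hedges puts the constant `-a
- b` in the cone. -/
theorem superhedge_bddBelow (hM : IsMarket ge 𝒳 π) (hN : NoSureProfit ge 𝒳 π) {f : Ω → ℝ}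
    (hf : f ∈ completeMarket ge 𝒳) :
    BddBelow {a : ℝ | (f - fun _ => a) ∈ superhedgeCone ge 𝒳 π} := by
  have hf' : -f ∈ completeMarket ge 𝒳 := hM.completeSubmodule.neg_mem hf
  obtain ⟨b, hb⟩ := hM.superhedge_nonempty hf'
  refine ⟨-b, fun a ha => ?_⟩
  have h1 := hM.superhedgeCone_add ha hb
  have e : ((f - fun _ => a) + (-f - fun _ => b)) = fun _ => -a - b := by
    ext ω; simp; ring
  rw [e] at h1
  linarith [hN _ h1]

theorem superhedgePrice_le (hM : IsMarket ge 𝒳 π) (hN : NoSureProfit ge 𝒳 π) {f : Ω → ℝ}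
    (hf : f ∈ completeMarket ge 𝒳) {a : ℝ} (ha : (f - fun _ => a) ∈ superhedgeCone ge 𝒳 π) :
    superhedgePrice ge 𝒳 π f ≤ a :=
  csInf_le (hM.superhedge_bddBelow hN hf) ha

/-- The infimum need not be attained, whence the strict inequality and the `ε` of slack in the
estimates that use it. -/
theorem superhedge_of_price_lt (hM : IsMarket ge 𝒳 π) {f : Ω → ℝ}
    (hf : f ∈ completeMarket ge 𝒳) {a : ℝ} (ha : superhedgePrice ge 𝒳 π f < a) :
    (f - fun _ => a) ∈ superhedgeCone ge 𝒳 π := by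
  obtain ⟨b, hb, hba⟩ := exists_lt_of_csInf_lt (hM.superhedge_nonempty hf) ha
  exact hM.superhedgeCone_of_ge hb (hM.order.of_le _ _ fun ω => sub_le_sub_left hba.le _)

theorem superhedgePrice_smul_le (hM : IsMarket ge 𝒳 π) (hN : NoSureProfit ge 𝒳 π) {f : Ω → ℝ}
    (hf : f ∈ completeMarket ge 𝒳) {c : ℝ} (hc : 0 < c) :
    superhedgePrice ge 𝒳 π (c • f) ≤ c * superhedgePrice ge 𝒳 π f := by
  refine le_of_forall_pos_le_add fun ε hε => ?_
  refine hM.superhedgePrice_le hN (hM.smul_mem_completeMarket hf c) ?_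
  have h1 := hM.superhedgeCone_smul (hM.superhedge_of_price_lt hf
    (lt_add_of_pos_right _ (div_pos hε hc))) hc
  convert h1 using 1
  ext ω
  simp only [Pi.sub_apply, Pi.smul_apply, smul_eq_mul]
  field_simp

theorem superhedgePrice_add_const_le (hM : IsMarket ge 𝒳 π) (hN : NoSureProfit ge 𝒳 π)
    {f : Ω → ℝ} (hf : f ∈ completeMarket ge 𝒳) (a : ℝ) :
    superhedgePrice ge 𝒳 π (f + fun _ => a) ≤ superhedgePrice ge 𝒳 π f + a := by
  refine le_of_forall_pos_le_add fun ε hε => ?_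
  refine hM.superhedgePrice_le hN
    (hM.add_mem_completeMarket hf (hM.const_mem_completeMarket a)) ?_
  convert hM.superhedge_of_price_lt hf (lt_add_of_pos_right _ hε) using 1
  ext ω
  simp only [Pi.sub_apply, Pi.add_apply]
  ring

theorem isCashAdditiveCompletion_superhedgePrice (hM : IsMarket ge 𝒳 π)
    (ha : uniformClosure (superhedgeCone ge 𝒳 π) ∩ {f | Gt ge f 0} = ∅) :
    IsCashAdditiveCompletion ge 𝒳 π (superhedgePrice ge 𝒳 π) := by
  have hN := hM.noSureProfit ha
  refine ⟨⟨?_, ?_, ?_, ?_, ?_⟩, ?_, ?_⟩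
  · refine le_antisymm ?_ (le_csInf (hM.superhedge_nonempty hM.one_mem_completeMarket) ?_)
    · refine hM.superhedgePrice_le hN hM.one_mem_completeMarket ?_
      convert hM.zero_mem_superhedgeCone using 1
      ext ω
      simp
    · intro a h
      have := hN (1 - a) h
      linarith
  · intro c hc X hX _
    refine le_antisymm (hM.superhedgePrice_smul_le hN hX hc) ?_
    -- The reverse inequality is the same one for the factor `c⁻¹` and the claim `c • X`.
    have := hM.superhedgePrice_smul_le hN (hM.smul_mem_completeMarket hX c) (inv_pos.mpr hc)
    rw [smul_smul, inv_mul_cancel₀ hc.ne', one_smul, inv_mul_eq_div, le_div_iff₀ hc] at this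
    linarith
  · intro X hX Y hY hXY
    refine le_of_forall_pos_le_add fun ε hε => hM.superhedgePrice_le hN hXY ?_
    convert hM.superhedgeCone_add
      (hM.superhedge_of_price_lt hX (lt_add_of_pos_right _ (half_pos hε)))
      (hM.superhedge_of_price_lt hY (lt_add_of_pos_right _ (half_pos hε))) using 1
    ext ω
    simp only [Pi.sub_apply, Pi.add_apply]
    ring
  · intro X hX Y hY hXY
    refine le_of_forall_pos_le_add fun ε hε => hM.superhedgePrice_le hN hY ?_
    refine hM.superhedgeCone_of_ge
      (hM.superhedge_of_price_lt hX (lt_add_of_pos_right _ hε)) ?_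
    rw [sub_eq_add_neg, sub_eq_add_neg]
    exact hM.order.add_right hXY _
  · intro X hX hpos
    by_contra! hle
    -- A price at most `0` puts `X - ε / 2` in the cone for every `ε > 0`, so `X` is a uniform limit
    -- of elements of the cone.
    refine Set.eq_empty_iff_forall_notMem.mp ha X ⟨mem_uniformClosure_iff.mpr fun ε hε => ?_, hpos⟩
    refine ⟨_, hM.superhedge_of_price_lt hX (hle.trans_lt (half_pos hε)), fun ω => ?_⟩
    rw [Pi.sub_apply, sub_sub_cancel, abs_of_pos (half_pos hε)]
    exact half_lt_self hε
  · exact fun X hX => hM.superhedgePrice_le hN (hM.subset_completeMarket hX)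
      (hM.sub_price_mem_superhedgeCone hX)
  · intro X hX a hXa
    refine le_antisymm (hM.superhedgePrice_add_const_le hN hX a) ?_
    have := hM.superhedgePrice_add_const_le hN hXa (-a)
    have e : ((X + fun _ => a) + fun _ => -a) = X := by ext ω; simp
    rw [e] at this
    linarith

end IsMarket

end Economy

/-! ### Hahn–Banach and pricing measures: (b) implies (c). -/

namespace Economy

variable {Ω : Type*} {ge : (Ω → ℝ) → (Ω → ℝ) → Prop} {𝒳 : Set (Ω → ℝ)} {π : (Ω → ℝ) → ℝ}

namespace IsMarket

/-- A linear functional below the price `ρ` that attains it at `v`. -/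
theorem exists_linear_le (hM : IsMarket ge 𝒳 π) {ρ : (Ω → ℝ) → ℝ}
    (hρ : IsPriceFunction ge (completeMarket ge 𝒳) ρ) {v : Ω → ℝ}
    (hv : v ∈ completeMarket ge 𝒳) (hv0 : v ≠ 0) :
    ∃ φ : (Ω → ℝ) →ₗ[ℝ] ℝ, φ v = ρ v ∧ ∀ g ∈ completeMarket ge 𝒳, φ g ≤ ρ g := by
  -- Domination on the line through `v`. For `c < 0` it comes from `0 = ρ 0 ≤ ρ (c • v) + ρ (-c •
  -- v)`.
  have hmul : ∀ c : ℝ, c * ρ v ≤ ρ (c • v) := by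
    have hzero : ρ 0 = 0 := by
      have h0 : (0 : Ω → ℝ) ∈ completeMarket ge 𝒳 := hM.completeSubmodule.zero_mem
      have := hρ.pos_homogeneous 2 two_pos 0 h0 (by simpa using h0)
      rw [smul_zero] at this
      linarith
    intro c
    have hcv := hM.smul_mem_completeMarket hv c
    rcases lt_trichotomy c 0 with hc | rfl | hc
    · have hncv := hM.smul_mem_completeMarket hv (-c)
      have h1 := hρ.pos_homogeneous (-c) (neg_pos.mpr hc) v hv hncv
      have h2 := hρ.subadditive _ hcv _ hncv (hM.add_mem_completeMarket hcv hncv)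
      rw [neg_smul, add_neg_cancel, hzero, ← neg_smul, h1] at h2
      linarith
    · rw [zero_mul, zero_smul, hzero]
    · exact (hρ.pos_homogeneous c hc v hv hcv).ge
  let E := hM.completeSubmodule
  let v' : E := ⟨v, hv⟩
  have hv' : v' ≠ 0 := fun h => hv0 (congrArg Subtype.val h)
  obtain ⟨g, hg, hgle⟩ := exists_extension_of_le_sublinear
    (LinearPMap.mkSpanSingleton (σ := RingHom.id ℝ) v' (ρ v) hv') (fun x : E => ρ x)
    (fun c hc x => hρ.pos_homogeneous c hc x x.2 (E.smul_mem c x.2))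
    (fun x y => hρ.subadditive x x.2 y y.2 (E.add_mem x.2 y.2))
    (by
      rintro ⟨x, hx⟩
      obtain ⟨c, rfl⟩ := Submodule.mem_span_singleton.mp hx
      rw [LinearPMap.mkSpanSingleton'_apply]
      exact hmul c)
  -- An arbitrary linear extension from `L(𝒳)` to all functions; no bound is claimed outside `L(𝒳)`.
  obtain ⟨φ, hφ⟩ := g.exists_extend
  have hφg : ∀ x : E, φ x = g x := fun x => LinearMap.congr_fun hφ x
  refine ⟨φ, ?_, fun x hx => (hφg ⟨x, hx⟩).trans_le (hgle ⟨x, hx⟩)⟩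
  refine (hφg v').trans ((hg ⟨v', Submodule.mem_span_singleton_self v'⟩).trans ?_)
  exact LinearPMap.mkSpanSingleton_apply ℝ ℝ hv' (ρ v)

variable {ρ : (Ω → ℝ) → ℝ} {φ : (Ω → ℝ) →ₗ[ℝ] ℝ}

/-- Every multiple satisfies `1 ≥_* n f`, so `n φ(f) ≤ ρ(1) = 1` for all `n > 0`. -/
theorem linear_nonpos (hM : IsMarket ge 𝒳 π)
    (hρ : IsPriceFunction ge (completeMarket ge 𝒳) ρ)
    (hφ : ∀ g ∈ completeMarket ge 𝒳, φ g ≤ ρ g) {f : Ω → ℝ} (hf : f ∈ completeMarket ge 𝒳)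
    (h0 : ge 0 f) : φ f ≤ 0 := by
  refine le_of_forall_pos_le_add fun ε hε => ?_
  have h1 : ∀ n : ℝ, 0 < n → n * φ f ≤ 1 := fun n hn => by
    rw [← smul_eq_mul, ← map_smul]
    have hnf := hM.smul_mem_completeMarket hf n
    refine (hφ _ hnf).trans (hρ.one ▸ hρ.mono _ hM.one_mem_completeMarket _ hnf ?_)
    have := hM.order.smul h0 hn.le
    rw [smul_zero] at this
    exact hM.order.trans _ _ _ (hM.order.of_le _ _ zero_le_one) this
  have := h1 ε⁻¹ (inv_pos.mpr hε)
  rw [inv_mul_eq_div, div_le_one hε] at this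
  linarith

theorem isPositiveOn (hM : IsMarket ge 𝒳 π) (hρ : IsCashAdditiveCompletion ge 𝒳 π ρ)
    (hφ : ∀ g ∈ completeMarket ge 𝒳, φ g ≤ ρ g) :
    FinAdd.IsPositiveOn (completeMarket ge 𝒳) φ where
  solid f hf g hg := hM.mem_completeMarket_of_ge hf (hM.order.of_le _ _ hg)
  bounded_mem := hM.bounded_mem_completeMarket
  nonneg f hf h0 := by
    have := hM.linear_nonpos hρ.price hφ (hM.completeSubmodule.neg_mem hf)
      (hM.order.of_le _ _ fun ω => neg_nonpos.mpr (h0 ω))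
    rw [map_neg] at this
    linarith
  one := by
    have h1 := hφ 1 hM.one_mem_completeMarket
    rw [hρ.price.one] at h1
    -- Writing `-1 = 1 - 2`, cash additivity gives `ρ(-1) = -1`, hence `φ(1) ≥ 1`; the bound `φ(1) ≤
    -- ρ(1) = 1` is immediate.
    have e : (1 + fun _ => -2 : Ω → ℝ) = -1 := by ext ω; simp; norm_num
    have hneg : (-1 : Ω → ℝ) ∈ completeMarket ge 𝒳 :=
      hM.completeSubmodule.neg_mem hM.one_mem_completeMarket
    have h2 := hρ.cashAdditive 1 hM.one_mem_completeMarket (-2) (by rwa [e])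
    rw [e, hρ.price.one] at h2
    have h3 := hφ (-1) hneg
    rw [map_neg] at h3
    linarith

theorem ofFunctional_mem_pricingMeasures (hM : IsMarket ge 𝒳 π)
    (hρ : IsCashAdditiveCompletion ge 𝒳 π ρ) (hφ : ∀ g ∈ completeMarket ge 𝒳, φ g ≤ ρ g) :
    FinAdd.ofFunctional φ ∈ pricingMeasures ge 𝒳 π := by
  have hpos := hM.isPositiveOn hρ hφ
  refine ⟨hpos.prob, fun A hA => ?_, fun g hg => hpos.integrable hg, fun X hX => ?_⟩
  · exact le_antisymm (hM.linear_nonpos hρ.price hφ (hpos.indicator_mem A) hA) (hpos.prob.1 A)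
  -- The integral is known to be at most `φ` only for functions with a `φ`-null negative part; the
  -- lower bound `a` makes `X - a` such a function.
  · obtain ⟨a, ha⟩ := hM.bounded_loss X hX
    have hXL := hM.subset_completeMarket hX
    have hd : (X - fun _ => a) ∈ completeMarket ge 𝒳 :=
      hM.completeSubmodule.sub_mem hXL (hM.const_mem_completeMarket a)
    obtain ⟨I, hI, hXI, -⟩ := hpos.exists_hasIntegral_of_negPart hd
      (hM.linear_nonpos hρ.price hφ (hpos.negPart_mem hd)
        (hM.order.negPart (hM.order.sub_nonneg ha)))
    have h1 := hXI.add hpos.prob (FinAdd.HasIntegral.const hpos.prob a)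
    simp only [Pi.sub_apply, sub_add_cancel] at h1
    rw [h1.integral_eq hpos.prob]
    rw [map_sub, hpos.const] at hI
    linarith [hφ X hXL, hρ.le X hX]

theorem trunc_mem_completeMarket (hM : IsMarket ge 𝒳 π) {f : Ω → ℝ} (hf : ge f 0) :
    f ⊓ 1 ∈ completeMarket ge 𝒳 :=
  ⟨1, one_pos, 1, hM.one_mem, by simpa using hM.order.one_ge_abs_trunc hf⟩

theorem exists_pricingMeasure_pos (hM : IsMarket ge 𝒳 π)
    (hρ : IsCashAdditiveCompletion ge 𝒳 π ρ) {f : Ω → ℝ} (hf : Gt ge f 0) :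
    ∃ m ∈ pricingMeasures ge 𝒳 π, 0 < FinAdd.integral m (f ⊓ 1) := by
  have hv := hM.trunc_mem_completeMarket hf.1
  have hgt := hM.order.trunc f hf
  obtain ⟨φ, hφv, hφ⟩ := hM.exists_linear_le hρ.price hv
    (fun h0 => hgt.2 (h0 ▸ hM.order.refl 0))
  have hpos := hM.isPositiveOn hρ hφ
  refine ⟨_, hM.ofFunctional_mem_pricingMeasures hρ hφ, ?_⟩
  obtain ⟨I, -, hI, hIφ⟩ := hpos.exists_hasIntegral_of_negPart hv
    (hM.linear_nonpos hρ.price hφ (hpos.negPart_mem hv) (hM.order.negPart hgt.1))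
  -- Since `f ∧ 1` is bounded above by `1`, the integral loses nothing: it equals `φ(f ∧ 1) = ρ(f ∧
  -- 1)`.
  rw [hI.integral_eq hpos.prob, hIφ ⟨1, fun ω => inf_le_right⟩, hφv]
  exact hρ.price.no_arbitrage _ hv hgt

/-! ### Integration against pricing measures: (c) implies (a). -/

theorem hasIntegral_mono (hM : IsMarket ge 𝒳 π) {m : FinAdd.SetFunction Ω}
    (hm : m ∈ pricingMeasures ge 𝒳 π) {f g : Ω → ℝ} {I J : ℝ} (hf : FinAdd.HasIntegral m f I)
    (hg : FinAdd.HasIntegral m g J) (hgf : ge g f) : I ≤ J :=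
  hf.mono hm.1 hg fun _ hε =>
    hm.2.1 _ (hM.order.negligible_of_nonneg (hM.order.sub_nonneg hgf) hε)

theorem integral_trunc_nonpos (hM : IsMarket ge 𝒳 π) {m : FinAdd.SetFunction Ω}
    (hm : m ∈ pricingMeasures ge 𝒳 π) {f : Ω → ℝ} (hf : ge f 0)
    (hcl : f ∈ uniformClosure (superhedgeCone ge 𝒳 π)) : FinAdd.integral m (f ⊓ 1) ≤ 0 := by
  refine le_of_forall_pos_le_add fun ε hε => ?_
  obtain ⟨g, ⟨c, hc, X, hX, hg⟩, hfg⟩ := mem_uniformClosure_iff.mp hcl ε hε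
  have hP := hm.1
  have hv := (hm.2.2.1 _ (hM.trunc_mem_completeMarket hf)).hasIntegral hP
  have hXI := (hm.2.2.1 _ (hM.subset_completeMarket hX)).hasIntegral hP
  have h1 := hv.sub hP (FinAdd.HasIntegral.const hP ε)
  have h2 := (hXI.sub hP (FinAdd.HasIntegral.const hP (π X))).const_mul hP c
  -- The chain `c (X - π(X)) ≥_* g ≥ f ∧ 1 - ε` is integrated. Truncating keeps the right end in
  -- `L(𝒳)`, whereas `f` itself need not be integrable.
  have h3 := hM.hasIntegral_mono hm h1 h2 (hM.order.trans _ _ _ hg (hM.order.of_le _ _ fun ω => by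
    have := (abs_lt.mp (hfg ω)).2
    have h4 : (f ⊓ 1) ω ≤ f ω := inf_le_left
    show (f ⊓ 1) ω - ε ≤ g ω
    linarith))
  have h5 := mul_nonpos_of_nonneg_of_nonpos hc.le (sub_nonpos.mpr (hm.2.2.2 X hX))
  linarith

end IsMarket

end Economy

/-- For a market `(𝒳, ≥_*, π)`: no free lunch with vanishing risk, the existence of a cash additive
completion, and the absence of pure bubbles are equivalent. The supremum is taken in the extended
reals, so that it would be `⊥` over an empty family. -/
theorem mainTheorem1 {Ω : Type*} [Nonempty Ω] (ge : (Ω → ℝ) → (Ω → ℝ) → Prop)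
    (𝒳 : Set (Ω → ℝ)) (π : (Ω → ℝ) → ℝ) (hM : Economy.IsMarket ge 𝒳 π) :
    List.TFAE [
      Economy.uniformClosure (Economy.superhedgeCone ge 𝒳 π) ∩ {f | Economy.Gt ge f 0} = ∅,
      ∃ ρ : (Ω → ℝ) → ℝ, Economy.IsCashAdditiveCompletion ge 𝒳 π ρ,
      ∀ f : Ω → ℝ, Economy.Gt ge f 0 →
        (0 : EReal) < ⨆ m ∈ Economy.pricingMeasures ge 𝒳 π,
          ((FinAdd.integral m (f ⊓ 1) : ℝ) : EReal)] := by
  tfae_have 1 → 2 := fun h => ⟨_, hM.isCashAdditiveCompletion_superhedgePrice h⟩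
  tfae_have 2 → 3 := by
    rintro ⟨ρ, hρ⟩ f hf
    obtain ⟨m, hm, hpos⟩ := hM.exists_pricingMeasure_pos hρ hf
    exact lt_of_lt_of_le (EReal.coe_pos.mpr hpos)
      (le_iSup₂ (f := fun m _ => ((FinAdd.integral m (f ⊓ 1) : ℝ) : EReal)) m hm)
  tfae_have 3 → 1 := by
    refine fun h => Set.eq_empty_iff_forall_notMem.mpr ?_
    rintro f ⟨hcl, hf⟩
    refine (h f hf).not_ge (iSup₂_le fun m hm => ?_)
    exact EReal.coe_nonpos.mpr (hM.integral_trunc_nonpos hm hf.1 hcl)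
  tfae_finish
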